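/- Let $V$ be a complex nuclear space, i.e. a locally convex space such that for every continuous seminorm $p$ on $V$ there is a continuous seminorm $q\ge p$ for which the canonical map $\widehat V_q\to\widehat V_p$ between the completions of $V/\ker q$ and $V/\ker p$ is a nuclear operator. Let $\mathcal T^\bullet_{\mathrm{alg}}(V)=\bigoplus_{k\ge 0}V^{\otimes k}$, write $\langle X\rangle_k$ for the degree-$k$ component of $X$, and let $\mathcal S^\bullet(V)\subseteq\mathcal T^\bullet_{\mathrm{alg}}(V)$ be the subspace of symmetric tensors (the image of the symmetrisation operator). For a continuous positive (semidefinite) Hermitian form $\langle\cdot,\cdot\rangle_\alpha$ on $V$ let $\|v\|_\alpha=\sqrt{\langle v,v\rangle_\alpha}$ be its Hilbert seminorm, and let $\|X\|_\alpha^\bullet=\sqrt{\langle X,X\rangle_\alpha^\bullet}$, where $\langle\cdot,\cdot\rangle^\bullet_\alpha$ is the sesquilinear form on $\mathcal T^\bullet_{\mathrm{alg}}(V)$ for which different degrees are orthogonal and $$\langle x_1\otimes\cdots\otimes x_k,\,y_1\otimes\cdots\otimes y_k\rangle_\alpha^\bullet=k!\prod_{m=1}^k\langle x_m,y_m\rangle_\alpha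 .$$ For $R\in\mathbb R$ and a continuous seminorm $p$ on $V$ let $$p_R(X)=\sum_{k=0}^\infty (k!)^R\,p^{\otimes k}(\langle X\rangle_k),\qquad p^{\otimes k}(Y)=\inf\sum_{i}|c_i|\prod_{m=1}^k p(x_{i,m}),$$ the infimum being taken over all expressions $Y=\sum_i c_i\,x_{i,1}\otimes\cdots\otimes x_{i,k}$ as a finite sum with $c_i\in\mathbb C$ and $x_{i,m}\in V$ (so $p^{\otimes 0}$ is the absolute value on $V^{\otimes 0}=\mathbb C$). Then the locally convex topology on $\mathcal S^\bullet(V)$ defined by the (restrictions of the) seminorms $\|\cdot\|_\alpha^\bullet$ of all continuous positive Hermitian forms $\langle\cdot,\cdot\rangle_\alpha$ on $V$ coincides with the topology constructed by Waldmann (2014) for $R=\frac12$, i.e. with the locally convex topology defined by the (restrictions of the) seminorms $p_{1/2}$ of all continuous seminorms $p$ on $V$; equivalently, by the seminorms $p_{1/2}$ for all continuous Hilbert seminorms $p=\|\cdot\|_\alpha$ on $V$. -/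

import Mathlib

open scoped TensorProduct DirectSum ComplexConjugate

noncomputable section

namespace NuclearWeyl

/-! ### Nuclear spaces -/

section Nuclear

/-- A continuous linear map `T : E → F` between normed spaces is nuclear if
`T x = ∑ₙ fₙ(x) yₙ` for continuous linear functionals `fₙ` on `E` and vectors `yₙ` of `F` with
`∑ₙ ‖fₙ‖ ‖yₙ‖ < ∞`. -/
def IsNuclearMap {E F : Type*} [NormedAddCommGroup E] [NormedSpace ℂ E]
    [NormedAddCommGroup F] [NormedSpace ℂ F] (T : E →L[ℂ] F) : Prop :=
  ∃ (f : ℕ → E →L[ℂ] ℂ) (y : ℕ → F), Summable (fun n => ‖f n‖ * ‖y n‖) ∧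
    ∀ x, HasSum (fun n => f n x • y n) (T x)

variable {V : Type*} [AddCommGroup V] [Module ℂ V]

/-- The vector space `V`, viewed as a seminormed space with the seminorm `p`. -/
def SeminormSpace (_p : Seminorm ℂ V) : Type _ := V

instance (p : Seminorm ℂ V) : SeminormedAddCommGroup (SeminormSpace p) :=
  p.toSeminormedAddCommGroup

instance (p : Seminorm ℂ V) : Module ℂ (SeminormSpace p) := inferInstanceAs (Module ℂ V)

instance (p : Seminorm ℂ V) : NormedSpace ℂ (SeminormSpace p) where
  norm_smul_le c x := (map_smul_eq_mul p c x).le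

/-- The local Banach space of a seminorm `p` on `V`: the (Hausdorff) completion of `(V, p)`,
i.e. the completion of the normed space `V / ker p`. -/
abbrev LocalBanachSpace (p : Seminorm ℂ V) : Type _ :=
  UniformSpace.Completion (SeminormSpace p)

/-- The identity of `V` as a continuous linear map `(V, q) → (V, p)`, for `p ≤ q`. -/
def seminormSpaceMap {p q : Seminorm ℂ V} (h : p ≤ q) :
    SeminormSpace q →L[ℂ] SeminormSpace p :=
  LinearMap.mkContinuous
    ({ toFun := fun x => x, map_add' := fun _ _ => rfl, map_smul' := fun _ _ => rfl } :
      SeminormSpace q →ₗ[ℂ] SeminormSpace p) 1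
    (fun x => by rw [one_mul]; exact h x)

/-- The canonical map between the local Banach spaces of two seminorms `p ≤ q`. -/
def localBanachMap {p q : Seminorm ℂ V} (h : p ≤ q) :
    LocalBanachSpace q →L[ℂ] LocalBanachSpace p :=
  (seminormSpaceMap h).completion

variable (V) in
/-- A locally convex space (a topological vector space whose topology is given by its continuous
seminorms) is nuclear if for every continuous seminorm `p` there is a continuous seminorm `q ≥ p`
such that the canonical map from the local Banach space of `q` to the one of `p` is nuclear. -/
structure IsNuclearSpace [TopologicalSpace V] : Prop where
  locallyConvex : PolynormableSpace ℂ V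
  exists_nuclear : ∀ p : Seminorm ℂ V, Continuous p →
    ∃ (q : Seminorm ℂ V) (h : p ≤ q), Continuous q ∧ IsNuclearMap (localBanachMap h)

end Nuclear

/-! ### Positive Hermitian forms and Hilbert seminorms -/

/-- A positive Hermitian form on a complex vector space: antilinear in the first argument, linear
in the second, Hermitian and positive semidefinite. -/
structure PosHermForm (E : Type*) [AddCommGroup E] [Module ℂ E] where
  form : E →ₗ⋆[ℂ] E →ₗ[ℂ] ℂ
  conj_symm : ∀ x y, conj (form x y) = form y x
  nonneg : ∀ x, 0 ≤ (form x x).re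

namespace PosHermForm

variable {E : Type*} [AddCommGroup E] [Module ℂ E]

abbrev core (B : PosHermForm E) : PreInnerProductSpace.Core ℂ E where
  inner x y := B.form x y
  conj_inner_symm x y := B.conj_symm y x
  re_inner_nonneg x := B.nonneg x
  add_left x y z := by simp
  smul_left x y r := by simp

/-- The Hilbert seminorm `v ↦ √⟨v, v⟩` of a positive Hermitian form. -/
def seminorm (B : PosHermForm E) : Seminorm ℂ E :=
  Seminorm.of (fun x => √(B.form x x).re)
    (fun x y => by
      let := InnerProductSpace.Core.toSeminormedAddCommGroup (c := B.core)
      exact norm_add_le x y)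
    (fun c x => by
      let := InnerProductSpace.Core.toSeminormedAddCommGroup (c := B.core)
      let : NormedSpace ℂ E := InnerProductSpace.Core.toNormedSpace (c := B.core)
      exact norm_smul c x)

theorem seminorm_apply (B : PosHermForm E) (x : E) : B.seminorm x = √(B.form x x).re := rfl


/-- For `y ∈ Vᵏ`, the antilinear functional on `V^{⊗k}` with
`x₁ ⊗ ⋯ ⊗ xₖ ↦ ∏ₘ ⟨xₘ, yₘ⟩`. -/
def powerAux (B : PosHermForm E) (k : ℕ) (y : Fin k → E) : (⨂[ℂ]^k E) →ₗ⋆[ℂ] ℂ :=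
  (starLinearEquiv ℂ : ℂ ≃ₗ⋆[ℂ] ℂ).toLinearMap.comp
    (PiTensorProduct.lift
      ((MultilinearMap.mkPiAlgebra ℂ (Fin k) ℂ).compLinearMap fun m => B.form (y m)))

theorem powerAux_tprod (B : PosHermForm E) (k : ℕ) (x y : Fin k → E) :
    B.powerAux k y (PiTensorProduct.tprod ℂ x) = ∏ m, B.form (x m) (y m) := by
  simp only [powerAux, LinearMap.comp_apply, PiTensorProduct.lift.tprod,
    MultilinearMap.compLinearMap_apply, MultilinearMap.mkPiAlgebra_apply]
  change conj (∏ m, B.form (y m) (x m)) = _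
  simp only [map_prod, B.conj_symm]

theorem antilinear_ext {k : ℕ} {f g : (⨂[ℂ]^k E) →ₗ⋆[ℂ] ℂ}
    (h : ∀ x : Fin k → E, f (PiTensorProduct.tprod ℂ x) = g (PiTensorProduct.tprod ℂ x)) :
    f = g := by
  ext X
  induction X using PiTensorProduct.induction_on with
  | smul_tprod r x => rw [map_smulₛₗ, map_smulₛₗ, h]
  | add a b ha hb => rw [map_add, map_add, ha, hb]

/-- The map `powerAux` as a multilinear map. -/
def powerAuxMultilinear (B : PosHermForm E) (k : ℕ) :
    MultilinearMap ℂ (fun _ : Fin k => E) ((⨂[ℂ]^k E) →ₗ⋆[ℂ] ℂ) where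
  toFun := B.powerAux k
  map_update_add' {_} y i a b := antilinear_ext fun x => by
    rw [LinearMap.add_apply, powerAux_tprod, powerAux_tprod, powerAux_tprod]
    have := ((MultilinearMap.mkPiAlgebra ℂ (Fin k) ℂ).compLinearMap
      fun m => B.form (x m)).map_update_add y i a b
    simpa only [MultilinearMap.compLinearMap_apply, MultilinearMap.mkPiAlgebra_apply] using this
  map_update_smul' {_} y i c a := antilinear_ext fun x => by
    rw [LinearMap.smul_apply, powerAux_tprod, powerAux_tprod]
    have := ((MultilinearMap.mkPiAlgebra ℂ (Fin k) ℂ).compLinearMap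
      fun m => B.form (x m)).map_update_smul y i c a
    simpa only [MultilinearMap.compLinearMap_apply, MultilinearMap.mkPiAlgebra_apply] using this

/-- The sesquilinear form on `V^{⊗k}` with
`⟨x₁ ⊗ ⋯ ⊗ xₖ, y₁ ⊗ ⋯ ⊗ yₖ⟩ = ∏ₘ ⟨xₘ, yₘ⟩` (see `powerForm_tprod`). -/
def powerForm (B : PosHermForm E) (k : ℕ) : (⨂[ℂ]^k E) →ₗ⋆[ℂ] (⨂[ℂ]^k E) →ₗ[ℂ] ℂ :=
  (PiTensorProduct.lift (B.powerAuxMultilinear k)).flip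

theorem powerForm_tprod (B : PosHermForm E) (k : ℕ) (x y : Fin k → E) :
    B.powerForm k (PiTensorProduct.tprod ℂ x) (PiTensorProduct.tprod ℂ y) =
      ∏ m, B.form (x m) (y m) := by
  rw [powerForm, LinearMap.flip_apply, PiTensorProduct.lift.tprod]
  exact B.powerAux_tprod k x y

theorem exists_sum_tprod {k : ℕ} (X : ⨂[ℂ]^k E) :
    ∃ (n : ℕ) (c : Fin n → ℂ) (x : Fin n → Fin k → E),
      X = ∑ i, c i • PiTensorProduct.tprod ℂ (x i) := by
  induction X using PiTensorProduct.induction_on with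
  | smul_tprod r x => exact ⟨1, fun _ => r, fun _ => x, by simp⟩
  | add a b ha hb =>
    obtain ⟨n, c, x, rfl⟩ := ha
    obtain ⟨m, d, y, rfl⟩ := hb
    exact ⟨n + m, Fin.append c d, Fin.append x y, by simp [Fin.sum_univ_add]⟩

theorem powerForm_conj_symm (B : PosHermForm E) (k : ℕ) (X Y : ⨂[ℂ]^k E) :
    conj (B.powerForm k X Y) = B.powerForm k Y X := by
  obtain ⟨n, c, x, rfl⟩ := exists_sum_tprod X
  obtain ⟨m, d, y, rfl⟩ := exists_sum_tprod Y
  simp only [map_sum, LinearMap.sum_apply, map_smul, map_smulₛₗ, LinearMap.smul_apply,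
    powerForm_tprod, smul_eq_mul, map_mul, map_prod, B.conj_symm]
  simp only [Finset.mul_sum]
  rw [Finset.sum_comm]
  refine Finset.sum_congr rfl fun i _ => Finset.sum_congr rfl fun j _ => ?_
  rw [Complex.conj_conj]
  ring

open scoped ComplexOrder in
theorem gram_posSemidef (B : PosHermForm E) {n : ℕ} (x : Fin n → E) :
    (Matrix.of fun i j => B.form (x i) (x j)).PosSemidef := by
  rw [Matrix.posSemidef_iff_dotProduct_mulVec]
  refine ⟨Matrix.ext fun i j => by simp [Matrix.conjTranspose_apply, B.conj_symm], fun c => ?_⟩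
  have h : star c ⬝ᵥ ((Matrix.of fun i j => B.form (x i) (x j)).mulVec c) =
      B.form (∑ i, c i • x i) (∑ i, c i • x i) := by
    simp only [dotProduct, Matrix.mulVec, Finset.mul_sum, map_sum, LinearMap.sum_apply, map_smul,
      map_smulₛₗ, LinearMap.smul_apply, smul_eq_mul, Matrix.of_apply, Pi.star_apply]
    refine Finset.sum_comm.trans
      (Finset.sum_congr rfl fun i _ => Finset.sum_congr rfl fun j _ => ?_)
    simp only [RCLike.star_def]
    ring
  rw [h, Complex.le_def]
  refine ⟨B.nonneg _, ?_⟩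
  have := congrArg Complex.im (B.conj_symm (∑ i, c i • x i) (∑ i, c i • x i))
  simp only [Complex.conj_im] at this
  simp only [Complex.zero_im]
  linarith

open scoped ComplexOrder in
theorem gram_prod_posSemidef (B : PosHermForm E) {n k : ℕ} (x : Fin n → Fin k → E) :
    (Matrix.of fun i j => ∏ m, B.form (x i m) (x j m)).PosSemidef := by
  induction k with
  | zero =>
    have := Matrix.posSemidef_vecMulVec_self_star (fun _ : Fin n => (1 : ℂ))
    convert this using 1
    ext i j
    simp [Matrix.vecMulVec]
  | succ k ih =>
    have := (B.gram_posSemidef fun i => x i 0).hadamard (ih fun i m => x i m.succ)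
    have h : (Matrix.of fun i j => ∏ m, B.form (x i m) (x j m)) =
        (Matrix.of fun i j => B.form (x i 0) (x j 0)).hadamard
          (Matrix.of fun i j => ∏ m, B.form (x i (Fin.succ m)) (x j (Fin.succ m))) := by
      ext i j
      simp [Fin.prod_univ_succ]
    rw [h]
    exact this

open scoped ComplexOrder in
theorem powerForm_nonneg (B : PosHermForm E) (k : ℕ) (X : ⨂[ℂ]^k E) :
    0 ≤ (B.powerForm k X X).re := by
  obtain ⟨n, c, x, rfl⟩ := exists_sum_tprod X
  have := (Complex.le_def.1 ((B.gram_prod_posSemidef x).dotProduct_mulVec_nonneg c)).1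
  refine this.trans_eq (congrArg Complex.re ?_)
  simp only [dotProduct, Matrix.mulVec, Finset.mul_sum, map_sum, LinearMap.sum_apply, map_smul,
    map_smulₛₗ, LinearMap.smul_apply, smul_eq_mul, Matrix.of_apply, Pi.star_apply,
    powerForm_tprod]
  refine Finset.sum_comm.trans
    (Finset.sum_congr rfl fun i _ => Finset.sum_congr rfl fun j _ => ?_)
  simp only [RCLike.star_def]
  ring

end PosHermForm

/-! ### The tensor algebra and its symmetric part -/

section Tensors

variable (V : Type*) [AddCommGroup V] [Module ℂ V]

/-- The vector space underlying the tensor algebra, `⨁ₖ V^{⊗k}`. -/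
abbrev Tens : Type _ := ⨁ k : ℕ, ⨂[ℂ]^k V

/-- The symmetrisation operator in degree `k`: it maps `x₁ ⊗ ⋯ ⊗ xₖ` to
`1/k! ∑_σ x_{σ(1)} ⊗ ⋯ ⊗ x_{σ(k)}` (see `symmetrizeDegree_tprod`). -/
def symmetrizeDegree (k : ℕ) : (⨂[ℂ]^k V) →ₗ[ℂ] ⨂[ℂ]^k V :=
  ((k.factorial : ℂ)⁻¹) •
    ∑ σ : Equiv.Perm (Fin k), (PiTensorProduct.reindex ℂ (fun _ => V) σ.symm).toLinearMap

theorem symmetrizeDegree_tprod (k : ℕ) (x : Fin k → V) :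
    symmetrizeDegree V k (PiTensorProduct.tprod ℂ x) =
      ((k.factorial : ℂ)⁻¹) •
        ∑ σ : Equiv.Perm (Fin k), PiTensorProduct.tprod ℂ (fun m => x (σ m)) := by
  simp [symmetrizeDegree]

/-- The symmetrisation operator on `⨁ₖ V^{⊗k}`. -/
def symmetrize : Tens V →ₗ[ℂ] Tens V := DirectSum.lmap (symmetrizeDegree V)

/-- The symmetric tensors in `⨁ₖ V^{⊗k}`, i.e. the image of the symmetrisation operator. -/
def SymTens : Submodule ℂ (Tens V) := LinearMap.range (symmetrize V)

end Tensors

/-! ### Extension of Hilbert seminorms to the tensor algebra -/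

namespace PosHermForm

variable {V : Type*} [AddCommGroup V] [Module ℂ V]

theorem finite_support_tens (B : PosHermForm V) (X Y : Tens V) :
    (Function.support fun k => (k.factorial : ℂ) * B.powerForm k (X k) (Y k)).Finite := by
  refine (DFinsupp.finite_support X).subset fun k hk hX => hk ?_
  change X k = 0 at hX
  simp [hX]

/-- The extension of a positive Hermitian form from `V` to `⨁ₖ V^{⊗k}`: different degrees are
orthogonal and
`⟨x₁ ⊗ ⋯ ⊗ xₖ, y₁ ⊗ ⋯ ⊗ yₖ⟩ = k! ∏ₘ ⟨xₘ, yₘ⟩`. -/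
def tens (B : PosHermForm V) : PosHermForm (Tens V) where
  form := LinearMap.mk₂'ₛₗ _ _
    (fun X Y => ∑ᶠ k : ℕ, (k.factorial : ℂ) * B.powerForm k (X k) (Y k))
    (fun X X' Y => by
      rw [← finsum_add_distrib (B.finite_support_tens X Y) (B.finite_support_tens X' Y)]
      exact finsum_congr fun k => by simp [mul_add])
    (fun c X Y => by
      rw [smul_finsum]
      exact finsum_congr fun k => by
        simp only [DirectSum.smul_apply, map_smulₛₗ, LinearMap.smul_apply, smul_eq_mul, RingHom.id_apply]
        exact mul_left_comm _ _ _)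
    (fun X Y Y' => by
      rw [← finsum_add_distrib (B.finite_support_tens X Y) (B.finite_support_tens X Y')]
      exact finsum_congr fun k => by simp [mul_add])
    (fun c X Y => by
      rw [smul_finsum]
      exact finsum_congr fun k => by
        simp only [DirectSum.smul_apply, map_smulₛₗ, LinearMap.smul_apply, smul_eq_mul, RingHom.id_apply]
        exact mul_left_comm _ _ _)
  conj_symm X Y := by
    simp only [LinearMap.mk₂'ₛₗ_apply]
    refine ((starRingEnd ℂ).toAddMonoidHom.map_finsum (B.finite_support_tens X Y)).trans ?_
    exact finsum_congr fun k => by simp [powerForm_conj_symm]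
  nonneg X := by
    simp only [LinearMap.mk₂'ₛₗ_apply]
    have h := Complex.reAddGroupHom.map_finsum (B.finite_support_tens X X)
    rw [Complex.coe_reAddGroupHom] at h
    rw [h]
    refine finsum_nonneg fun k => ?_
    have := B.powerForm_nonneg k (X k)
    simp only [Complex.mul_re, Complex.natCast_re, Complex.natCast_im, zero_mul, sub_zero]
    positivity

theorem tens_apply (B : PosHermForm V) (X Y : Tens V) :
    B.tens.form X Y = ∑ᶠ k : ℕ, (k.factorial : ℂ) * B.powerForm k (X k) (Y k) := rfl

end PosHermForm

section HilbertTopology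

variable (V : Type*) [AddCommGroup V] [Module ℂ V] [TopologicalSpace V]

/-- The set of all continuous positive Hermitian forms on `V`. -/
abbrev ContPosHermForm : Type _ :=
  {B : PosHermForm V // Continuous fun v : V × V => B.form v.1 v.2}

/-- The locally convex topology on `⨁ₖ V^{⊗k}` defined by the extensions of all continuous
Hilbert seminorms of `V`. -/
abbrev hilbertTopology : TopologicalSpace (Tens V) :=
  (SeminormFamily.moduleFilterBasis
    (fun B : ContPosHermForm V => B.1.tens.seminorm : SeminormFamily ℂ (Tens V) _)).topology

/-- The topology on the symmetric tensors defined by the extensions of all continuous Hilbert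
seminorms of `V`, i.e. the subspace topology of `hilbertTopology`. -/
abbrev symHilbertTopology : TopologicalSpace (SymTens V) :=
  (hilbertTopology V).induced Subtype.val

end HilbertTopology

/-! ### Projective extension of seminorms to the tensor algebra -/

section Projective

variable {V : Type*} [AddCommGroup V] [Module ℂ V]

/-- The values `∑ᵢ |cᵢ| ∏ₘ p(x_{i,m})` over all expressions of `X` as a finite sum
`∑ᵢ cᵢ x_{i,1} ⊗ ⋯ ⊗ x_{i,k}`. -/
def projectiveValues (p : Seminorm ℂ V) (k : ℕ) (X : ⨂[ℂ]^k V) : Set ℝ :=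
  {r | ∃ (n : ℕ) (c : Fin n → ℂ) (x : Fin n → Fin k → V),
    X = ∑ i, c i • PiTensorProduct.tprod ℂ (x i) ∧ r = ∑ i, ‖c i‖ * ∏ m, p (x i m)}

theorem projectiveValues_nonempty (p : Seminorm ℂ V) (k : ℕ) (X : ⨂[ℂ]^k V) :
    (projectiveValues p k X).Nonempty := by
  obtain ⟨n, c, x, h⟩ := PosHermForm.exists_sum_tprod X
  exact ⟨_, n, c, x, h, rfl⟩

theorem projectiveValues_nonneg {p : Seminorm ℂ V} {k : ℕ} {X : ⨂[ℂ]^k V} {r : ℝ}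
    (h : r ∈ projectiveValues p k X) : 0 ≤ r := by
  obtain ⟨n, c, x, -, rfl⟩ := h
  exact Finset.sum_nonneg fun i _ =>
    mul_nonneg (norm_nonneg _) (Finset.prod_nonneg fun m _ => apply_nonneg p _)

theorem projectiveValues_bddBelow (p : Seminorm ℂ V) (k : ℕ) (X : ⨂[ℂ]^k V) :
    BddBelow (projectiveValues p k X) :=
  ⟨0, fun _ h => projectiveValues_nonneg h⟩

/-- The `k`-th projective tensor power of a seminorm `p`: the infimum of
`∑ᵢ |cᵢ| ∏ₘ p(x_{i,m})` over all expressions of `X` as a finite sum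
`∑ᵢ cᵢ x_{i,1} ⊗ ⋯ ⊗ x_{i,k}`. For `k ≥ 1` the coefficients can be absorbed into the vectors; for
`k = 0` this is the absolute value on `V^{⊗0} = ℂ`. -/
def projectivePower (p : Seminorm ℂ V) (k : ℕ) : Seminorm ℂ (⨂[ℂ]^k V) :=
  Seminorm.ofSMulLE (fun X => sInf (projectiveValues p k X))
    (le_antisymm
      (csInf_le (projectiveValues_bddBelow p k 0) ⟨0, Fin.elim0, Fin.elim0, by simp, by simp⟩)
      (le_csInf (projectiveValues_nonempty p k 0) fun _ h => projectiveValues_nonneg h))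
    (fun X Y => by
      rw [← csInf_add (projectiveValues_nonempty p k X) (projectiveValues_bddBelow p k X)
        (projectiveValues_nonempty p k Y) (projectiveValues_bddBelow p k Y)]
      refine csInf_le_csInf (projectiveValues_bddBelow p k _)
        ((projectiveValues_nonempty p k X).add (projectiveValues_nonempty p k Y)) ?_
      rintro _ ⟨_, ⟨n, c, x, rfl, rfl⟩, _, ⟨m, d, y, rfl, rfl⟩, rfl⟩
      exact ⟨n + m, Fin.append c d, Fin.append x y, by simp [Fin.sum_univ_add],
        by simp [Fin.sum_univ_add]⟩)
    (fun a X => by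
      rw [← smul_eq_mul, ← Real.sInf_smul_of_nonneg (norm_nonneg a)]
      refine csInf_le_csInf (projectiveValues_bddBelow p k _)
        ((projectiveValues_nonempty p k X).smul_set) ?_
      rintro _ ⟨_, ⟨n, c, x, rfl, rfl⟩, rfl⟩
      exact ⟨n, fun i => a * c i, x, by simp [Finset.smul_sum, mul_smul],
        by simp [Finset.mul_sum, mul_assoc]⟩)

theorem projectivePower_apply (p : Seminorm ℂ V) (k : ℕ) (X : ⨂[ℂ]^k V) :
    projectivePower p k X = sInf (projectiveValues p k X) := rfl

theorem finite_support_projective (R : ℝ) (p : Seminorm ℂ V) (X : Tens V) :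
    (Function.support fun k => (k.factorial : ℝ) ^ R * projectivePower p k (X k)).Finite := by
  refine (DFinsupp.finite_support X).subset fun k hk hX => hk ?_
  change X k = 0 at hX
  simp [hX]

/-- The seminorm `X ↦ ∑ₖ (k!)ᴿ p^{⊗k}(Xₖ)` on `⨁ₖ V^{⊗k}`, where `p^{⊗k}` is the projective
tensor power. -/
def projectiveTens (R : ℝ) (p : Seminorm ℂ V) : Seminorm ℂ (Tens V) :=
  Seminorm.of (fun X => ∑ᶠ k : ℕ, (k.factorial : ℝ) ^ R * projectivePower p k (X k))
    (fun X Y => by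
      rw [← finsum_add_distrib (finite_support_projective R p X)
        (finite_support_projective R p Y)]
      refine finsum_le_finsum' (finite_support_projective R p (X + Y))
        ((finite_support_projective R p X).union (finite_support_projective R p Y) |>.subset
          (Function.support_add _ _)) fun k => ?_
      rw [← mul_add]
      exact mul_le_mul_of_nonneg_left (map_add_le_add _ _ _) (by positivity))
    (fun c X => by
      rw [← smul_eq_mul, smul_finsum]
      exact finsum_congr fun k => by
        rw [DirectSum.smul_apply, map_smul_eq_mul, smul_eq_mul]
        exact mul_left_comm _ _ _)

theorem projectiveTens_apply (R : ℝ) (p : Seminorm ℂ V) (X : Tens V) :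
    projectiveTens R p X = ∑ᶠ k : ℕ, (k.factorial : ℝ) ^ R * projectivePower p k (X k) := rfl

/-- The locally convex topology on the symmetric tensors which is defined by the restrictions of
the seminorms `X ↦ ∑ₖ (k!)ᴿ p^{⊗k}(Xₖ)`, where `p` runs through the given set `P` of seminorms
of `V`. -/
abbrev symProjectiveTopologyOf (R : ℝ) (P : Set (Seminorm ℂ V)) : TopologicalSpace (SymTens V) :=
  (SeminormFamily.moduleFilterBasis
    (fun p : P => projectiveTens R p.1 : SeminormFamily ℂ (Tens V) _)).topology.induced
      Subtype.val

variable (V) in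
/-- The projective topology with parameter `R` on the symmetric tensors: the one defined by the
seminorms `X ↦ ∑ₖ (k!)ᴿ p^{⊗k}(Xₖ)` for all continuous seminorms `p` of `V`. -/
abbrev symProjectiveTopology [TopologicalSpace V] (R : ℝ) : TopologicalSpace (SymTens V) :=
  symProjectiveTopologyOf R {p : Seminorm ℂ V | Continuous p}

variable (V) in
/-- The set of all continuous Hilbert seminorms of `V`. -/
def hilbertSeminorms [TopologicalSpace V] : Set (Seminorm ℂ V) :=
  Set.range fun B : ContPosHermForm V => B.1.seminorm

end Projective

end NuclearWeyl

end


/-! On `V^{⊗k}` the Hilbert seminorm never exceeds the projective one, and the degrees being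
orthogonal, the weight `k!` inside the Hilbert norm becomes `√k!` in a sum of seminorms: this is why
`R = 1/2`. Conversely, a nuclear canonical map `(V, q) → (V, p)` factors as
`x ↦ ∑ᵢ ⟨eᵢ, Φ x⟩ wᵢ` through `ℓ²`, with `Φ` bounded for `q` and `ρ² = ∑ᵢ p(wᵢ)²` as small as we
like. Tensoring this expansion gives
`p^{⊗k}(X) ≤ ∑ᵣ |⟨e_{r₁} ⊗ ⋯ ⊗ e_{rₖ}, Φ^{⊗k} X⟩| ∏ₘ p(w_{rₘ})`, which by the inequalities of
Cauchy–Schwarz and Bessel is at most `ρᵏ` times the Hilbert norm of `Φ^{⊗k} X`; for `ρ < 1` the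
factors `ρᵏ` are summable over all degrees. -/

noncomputable section

namespace NuclearWeyl

open Filter Topology UniformSpace
open scoped NNReal lp

section NuclearFactorization

variable {E F : Type*} [NormedAddCommGroup E] [NormedSpace ℂ E] [SeminormedAddCommGroup F]

theorem exists_hasSum_coe_completion (y : Completion F) {ε : ℝ} (hε : 0 < ε) :
    ∃ v : ℕ → F, (Summable fun n => ‖v n‖) ∧ ∑' n, ‖v n‖ ≤ ‖y‖ + ε ∧
      HasSum (fun n => (v n : Completion F)) y := by
  obtain ⟨b, hb0, c, hbc, hcε⟩ := posSumOfEncodable (half_pos hε) ℕ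
  have hy : y ∈ closure (Completion.toCompl (α := F)).range :=
    Completion.denseRange_coe y
  obtain ⟨v, hlim, hv0, hv⟩ := controlled_sum_of_mem_closure_range hy hb0
  have hv_le : ∀ n, ‖v n‖ ≤ b n + if n = 0 then ‖y‖ else 0 := by
    rintro (_ | n)
    · rw [neg_add_eq_sub] at hv0
      have h0 : ‖v 0‖ ≤ ‖y‖ + ‖y - v 0‖ := by
        simpa only [Completion.norm_coe] using norm_le_norm_add_norm_sub y (v 0 : Completion F)
      rw [if_pos rfl]
      exact h0.trans (by linarith [show ‖y - v 0‖ < b 0 from hv0])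
    · simpa using (hv (n + 1) n.succ_pos).le
  have hsum := hbc.add (hasSum_ite_eq 0 ‖y‖)
  have hv_summable : Summable fun n => ‖v n‖ :=
    .of_nonneg_of_le (fun n => norm_nonneg _) hv_le hsum.summable
  refine ⟨v, hv_summable, ?_, ?_⟩
  · refine (hv_summable.tsum_le_tsum hv_le hsum.summable).trans ?_
    rw [hsum.tsum_eq]; linarith
  · have : Summable fun n => (v n : Completion F) :=
      .of_norm (by simpa only [Completion.norm_coe] using hv_summable)
    exact this.hasSum_iff_tendsto_nat.2 ((tendsto_add_atTop_iff_nat 1).1 hlim)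

variable [NormedSpace ℂ F]

theorem exists_balanced_rankOne (f : E →L[ℂ] ℂ) (v : F) {ε : ℝ} (hε : 0 < ε) :
    ∃ (g : E →L[ℂ] ℂ) (w : F), ‖g‖ ^ 2 ≤ ε⁻¹ * (‖f‖ * ‖v‖) ∧ ‖w‖ ^ 2 ≤ ε * (‖f‖ * ‖v‖) ∧
      ∀ x, g x • (w : Completion F) = f x • (v : Completion F) := by
  rcases eq_or_ne (‖f‖ * ‖v‖) 0 with h0 | h0
  · refine ⟨0, 0, by simp [h0], by simp [h0], fun x => ?_⟩
    rcases mul_eq_zero.1 h0 with hf | hv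
    · simp [norm_eq_zero.1 hf]
    · rw [← Completion.norm_coe, norm_eq_zero] at hv
      simp [hv]
  · have hf : 0 < ‖f‖ := (norm_nonneg f).lt_of_ne' (left_ne_zero_of_mul h0)
    have hv : 0 < ‖v‖ := (norm_nonneg v).lt_of_ne' (right_ne_zero_of_mul h0)
    set c : ℝ := √(‖v‖ / (ε * ‖f‖))
    have hc : 0 < c := by positivity
    have hc2 : c ^ 2 = ‖v‖ / (ε * ‖f‖) := Real.sq_sqrt (by positivity)
    refine ⟨(c : ℂ) • f, (c : ℂ)⁻¹ • v, ?_, ?_, fun x => ?_⟩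
    · rw [norm_smul, mul_pow, Complex.norm_real, Real.norm_of_nonneg hc.le, hc2]
      apply le_of_eq
      field_simp
    · rw [norm_smul, mul_pow, norm_inv, Complex.norm_real, Real.norm_of_nonneg hc.le, inv_pow, hc2]
      apply le_of_eq
      field_simp
    · have : (c : ℂ) ≠ 0 := by exact_mod_cast hc.ne'
      rw [Completion.coe_smul, smul_smul, smul_apply, smul_eq_mul]
      congr 1
      field_simp

theorem IsNuclearMap.exists_hasSum_coe {T : E →L[ℂ] Completion F} (hT : IsNuclearMap T) :
    ∃ (f : ℕ × ℕ → E →L[ℂ] ℂ) (v : ℕ × ℕ → F), (Summable fun i => ‖f i‖ * ‖v i‖) ∧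
      ∀ x, HasSum (fun i => f i x • (v i : Completion F)) (T x) := by
  obtain ⟨f, y, hfy, hT⟩ := hT
  choose v hv hv_le hvy using fun n => exists_hasSum_coe_completion (y n)
    (ε := (1 / 2) ^ n / (‖f n‖ + 1)) (by positivity)
  have hfv : Summable fun i : ℕ × ℕ => ‖f i.1‖ * ‖v i.1 i.2‖ := by
    rw [summable_prod_of_nonneg fun i => by positivity]
    refine ⟨fun n => (hv n).mul_left ‖f n‖, ?_⟩
    refine .of_nonneg_of_le (fun n => tsum_nonneg fun m => by positivity) (fun n => ?_)
      (hfy.add summable_geometric_two)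
    calc ∑' m, ‖f n‖ * ‖v n m‖ = ‖f n‖ * ∑' m, ‖v n m‖ := tsum_mul_left
      _ ≤ ‖f n‖ * (‖y n‖ + (1 / 2) ^ n / (‖f n‖ + 1)) := by gcongr; exact hv_le n
      _ = ‖f n‖ * ‖y n‖ + ‖f n‖ / (‖f n‖ + 1) * (1 / 2) ^ n := by ring
      _ ≤ ‖f n‖ * ‖y n‖ + (1 / 2) ^ n := by
        gcongr
        exact mul_le_of_le_one_left (by positivity)
          (div_le_one_of_le₀ (by linarith) (by positivity))
  refine ⟨fun i => f i.1, fun i => v i.1 i.2, hfv, fun x => ?_⟩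
  have hsum : Summable fun i : ℕ × ℕ => f i.1 x • (v i.1 i.2 : Completion F) := by
    refine .of_norm_bounded (hfv.mul_right ‖x‖) fun i => ?_
    rw [norm_smul, Completion.norm_coe, mul_right_comm]
    gcongr
    exact (f i.1).le_opNorm x
  have hfib := hsum.hasSum.prod_fiberwise fun n => (hvy n).const_smul (f n x)
  exact (hT x).unique hfib ▸ hsum.hasSum

theorem exists_l2_map_of_summable_sq {ι : Type*} {f : ι → E →L[ℂ] ℂ}
    (hf : Summable fun i => ‖f i‖ ^ 2) :
    ∃ Φ : E →L[ℂ] ℓ²(ι, ℂ), ∀ x i, Φ x i = f i x := by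
  have hle : ∀ x i, ‖f i x‖ ^ 2 ≤ ‖f i‖ ^ 2 * ‖x‖ ^ 2 := fun x i => by
    rw [← mul_pow]
    gcongr
    exact (f i).le_opNorm x
  have hmem : ∀ x, Memℓp (fun i => f i x) 2 := fun x =>
    memℓp_gen (by
      simpa using Summable.of_nonneg_of_le (fun i => by positivity) (hle x) (hf.mul_right _))
  refine ⟨LinearMap.mkContinuous
    { toFun x := ⟨fun i => f i x, hmem x⟩
      map_add' x y := by ext i; exact map_add (f i) x y
      map_smul' c x := by ext i; exact map_smul (f i) c x }
    √(∑' i, ‖f i‖ ^ 2) fun x => ?_, fun x i => rfl⟩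
  refine lp.norm_le_of_forall_sum_le (by simp) (by positivity) fun s => ?_
  simp only [ENNReal.toReal_ofNat, Real.rpow_ofNat, mul_pow]
  rw [Real.sq_sqrt (tsum_nonneg fun i => by positivity)]
  calc ∑ i ∈ s, ‖f i x‖ ^ 2
      ≤ ∑ i ∈ s, ‖f i‖ ^ 2 * ‖x‖ ^ 2 := Finset.sum_le_sum fun i _ => hle x i
    _ ≤ (∑' i, ‖f i‖ ^ 2) * ‖x‖ ^ 2 := by
      rw [← Finset.sum_mul]
      gcongr
      exact hf.sum_le_tsum s fun i _ => by positivity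

theorem IsNuclearMap.exists_l2_factorization {T : E →L[ℂ] Completion F} (hT : IsNuclearMap T)
    {δ : ℝ} (hδ : 0 < δ) :
    ∃ (Φ : E →L[ℂ] ℓ²(ℕ × ℕ, ℂ)) (w : ℕ × ℕ → F), (∀ s : Finset _, ∑ i ∈ s, ‖w i‖ ^ 2 ≤ δ) ∧
      ∀ x, HasSum (fun i => Φ x i • (w i : Completion F)) (T x) := by
  obtain ⟨f, v, hfv, hT⟩ := hT.exists_hasSum_coe
  set S := ∑' i, ‖f i‖ * ‖v i‖
  have : 0 ≤ S := tsum_nonneg fun i => by positivity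
  choose g w hg hw hgw using fun i =>
    exists_balanced_rankOne (f i) (v i) (ε := δ / (S + 1)) (by positivity)
  obtain ⟨Φ, hΦ⟩ := exists_l2_map_of_summable_sq
    (.of_nonneg_of_le (fun i => by positivity) hg (hfv.mul_left _))
  refine ⟨Φ, w, fun s => ?_, fun x => by simpa only [hΦ, hgw] using hT x⟩
  calc ∑ i ∈ s, ‖w i‖ ^ 2
      ≤ ∑ i ∈ s, δ / (S + 1) * (‖f i‖ * ‖v i‖) := Finset.sum_le_sum fun i _ => hw i
    _ ≤ δ / (S + 1) * S := by
      rw [← Finset.mul_sum]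
      gcongr
      exact hfv.sum_le_tsum s fun i _ => by positivity
    _ ≤ δ := by
      rw [div_mul_eq_mul_div]
      exact div_le_of_le_mul₀ (by positivity) hδ.le (by nlinarith)

theorem IsNuclearMap.exists_l2_expansion {V : Type*} [AddCommGroup V] [Module ℂ V]
    {p q : Seminorm ℂ V} {h : p ≤ q} (hn : IsNuclearMap (localBanachMap h)) {δ : ℝ} (hδ : 0 < δ) :
    ∃ (Φ : V →ₗ[ℂ] ℓ²(ℕ × ℕ, ℂ)) (C : ℝ) (w : ℕ × ℕ → V), (∀ x, ‖Φ x‖ ≤ C * q x) ∧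
      (∀ s : Finset _, ∑ i ∈ s, p (w i) ^ 2 ≤ δ) ∧
      ∀ x, Tendsto (fun s : Finset _ => p (x - ∑ i ∈ s, Φ x i • w i)) atTop (𝓝 0) := by
  obtain ⟨Φ, w, hw, hΦ⟩ := hn.exists_l2_factorization hδ
  let ι : SeminormSpace q →L[ℂ] LocalBanachSpace q := Completion.toComplL
  let κ : SeminormSpace p →L[ℂ] LocalBanachSpace p := Completion.toComplL
  refine ⟨(Φ ∘L ι).toLinearMap, ‖Φ ∘L ι‖, w, (Φ ∘L ι).le_opNorm, hw, fun x => ?_⟩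
  have hιx : localBanachMap h (ι x) = κ (seminormSpaceMap h x) :=
    ContinuousLinearMap.completion_apply_coe (seminormSpaceMap h) x
  have hx : HasSum (fun i => Φ (ι x) i • κ (w i)) (κ (seminormSpaceMap h x)) := hιx ▸ hΦ (ι x)
  have hκ : ∀ s : Finset _, κ (seminormSpaceMap h x - ∑ i ∈ s, Φ (ι x) i • w i) =
      κ (seminormSpaceMap h x) - ∑ i ∈ s, Φ (ι x) i • κ (w i) := fun s => by
    simp only [map_sub, map_sum, map_smul]
  refine (tendsto_iff_norm_sub_tendsto_zero.1 hx).congr fun s => ?_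
  rw [norm_sub_rev, ← hκ]
  exact Completion.norm_coe _

end NuclearFactorization

namespace PosHermForm

variable {E H : Type*} [AddCommGroup E] [Module ℂ E] [AddCommGroup H] [Module ℂ H]

/-- The `k`-th tensor power of a positive Hermitian form, on `E^{⊗k}`; the weight `k!` occurs only
in `PosHermForm.tens`. -/
def power (B : PosHermForm E) (k : ℕ) : PosHermForm (⨂[ℂ]^k E) where
  form := B.powerForm k
  conj_symm := B.powerForm_conj_symm k
  nonneg := B.powerForm_nonneg k

/-- The pullback `(x, y) ↦ ⟨T x, T y⟩` of a positive Hermitian form along a linear map. -/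
def comap (B : PosHermForm H) (T : E →ₗ[ℂ] H) : PosHermForm E where
  form := (B.form.comp T).compl₂ T
  conj_symm x y := B.conj_symm (T x) (T y)
  nonneg x := B.nonneg (T x)

/-- The inner product of a pre-Hilbert space, as a positive Hermitian form. -/
def ofInner (H : Type*) [SeminormedAddCommGroup H] [InnerProductSpace ℂ H] : PosHermForm H where
  form := innerₛₗ ℂ
  conj_symm x y := inner_conj_symm y x
  nonneg _ := inner_self_nonneg (𝕜 := ℂ)

theorem power_comap_form (B : PosHermForm H) (T : E →ₗ[ℂ] H) (k : ℕ) (X Y : ⨂[ℂ]^k E) :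
    ((B.comap T).power k).form X Y = (B.power k).form
      (PiTensorProduct.map (fun _ => T) X) (PiTensorProduct.map (fun _ => T) Y) := by
  obtain ⟨n, c, x, rfl⟩ := exists_sum_tprod X
  obtain ⟨m, d, y, rfl⟩ := exists_sum_tprod Y
  simp [power, comap, powerForm_tprod]

theorem power_comap_seminorm (B : PosHermForm H) (T : E →ₗ[ℂ] H) (k : ℕ) (X : ⨂[ℂ]^k E) :
    ((B.comap T).power k).seminorm X =
      (B.power k).seminorm (PiTensorProduct.map (fun _ => T) X) := by
  rw [seminorm_apply, power_comap_form, seminorm_apply]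

theorem seminorm_sq (B : PosHermForm E) (x : E) : B.seminorm x ^ 2 = (B.form x x).re :=
  Real.sq_sqrt (B.nonneg x)

/-- Orthonormality of a family with respect to a positive Hermitian form, which may be
degenerate. -/
def IsOrthonormal {ι : Type*} [DecidableEq ι] (B : PosHermForm E) (e : ι → E) : Prop :=
  ∀ i j, B.form (e i) (e j) = if i = j then 1 else 0

theorem IsOrthonormal.sum_norm_sq_le {ι : Type*} [DecidableEq ι] {B : PosHermForm E} {e : ι → E}
    (he : B.IsOrthonormal e) (s : Finset ι) (x : E) :
    ∑ i ∈ s, ‖B.form (e i) x‖ ^ 2 ≤ B.seminorm x ^ 2 := by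
  let := InnerProductSpace.Core.toSeminormedAddCommGroup (c := B.core)
  let : InnerProductSpace ℂ E := .ofCore B.core
  exact Orthonormal.sum_inner_products_le x (orthonormal_iff_ite.2 he)

theorem IsOrthonormal.power {ι : Type*} [DecidableEq ι] {B : PosHermForm E} {e : ι → E}
    (he : B.IsOrthonormal e) (k : ℕ) :
    (B.power k).IsOrthonormal fun r : Fin k → ι => PiTensorProduct.tprod ℂ fun m => e (r m) :=
  fun r r' => by
    change B.powerForm k _ _ = _
    simp only [powerForm_tprod, he _ _, Finset.prod_ite_zero, Finset.prod_const_one,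
      Finset.mem_univ, true_imp_iff, funext_iff]

theorem isOrthonormal_single (ι : Type*) [DecidableEq ι] :
    (ofInner ℓ²(ι, ℂ)).IsOrthonormal fun i => lp.single 2 i 1 := fun i j => by
  change inner ℂ (lp.single 2 i 1 : ℓ²(ι, ℂ)) (lp.single 2 j 1) = _
  rw [lp.inner_single_left, lp.single_apply]
  simp [Pi.single_apply]

end PosHermForm

section ProjectivePower

variable {V H ι : Type*} [AddCommGroup V] [Module ℂ V] [AddCommGroup H] [Module ℂ H]
  {p : Seminorm ℂ V} {k : ℕ}

theorem projectivePower_sum_tprod_le (p : Seminorm ℂ V) (s : Finset ι) (c : ι → ℂ)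
    (x : ι → Fin k → V) :
    projectivePower p k (∑ i ∈ s, c i • PiTensorProduct.tprod ℂ (x i)) ≤
      ∑ i ∈ s, ‖c i‖ * ∏ m, p (x i m) := by
  refine csInf_le (projectiveValues_bddBelow p k _)
    ⟨s.card, fun i => c (s.equivFin.symm i), fun i => x (s.equivFin.symm i), ?_, ?_⟩
  · rw [← Finset.sum_coe_sort]
    exact (Equiv.sum_comp s.equivFin.symm
      (fun i : s => c i • PiTensorProduct.tprod ℂ (x i))).symm
  · rw [← Finset.sum_coe_sort]
    exact (Equiv.sum_comp s.equivFin.symm (fun i : s => ‖c i‖ * ∏ m, p (x i m))).symm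

theorem projectivePower_tprod_le (p : Seminorm ℂ V) (x : Fin k → V) :
    projectivePower p k (PiTensorProduct.tprod ℂ x) ≤ ∏ m, p (x m) := by
  simpa using projectivePower_sum_tprod_le p {()} (fun _ => 1) (fun _ => x)

theorem tendsto_projectivePower_tprod_sub {α : Type*} {l : Filter α} {y : α → Fin k → V}
    {x : Fin k → V} (h : ∀ m, Tendsto (fun a => p (x m - y a m)) l (𝓝 0)) :
    Tendsto (fun a => projectivePower p k
      (PiTensorProduct.tprod ℂ x - PiTensorProduct.tprod ℂ (y a))) l (𝓝 0) := by
  let τ : MultilinearMap ℂ (fun _ : Fin k => SeminormSpace p)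
      (SeminormSpace (projectivePower p k)) :=
    (PiTensorProduct.tprod ℂ : MultilinearMap ℂ (fun _ : Fin k => V) (⨂[ℂ]^k V))
  have hτ : Continuous τ := τ.continuous_of_bound 1 fun m =>
    (projectivePower_tprod_le p m).trans_eq (one_mul _).symm
  have hy : Tendsto (β := Fin k → SeminormSpace p) y l (𝓝 x) :=
    (tendsto_pi_nhds (A := fun _ : Fin k => SeminormSpace p)).2 fun m =>
      (tendsto_iff_norm_sub_tendsto_zero (E := SeminormSpace p)).2
        ((h m).congr fun a => map_sub_rev p (x m) (y a m))
  exact (tendsto_iff_norm_sub_tendsto_zero.1 ((hτ.tendsto _).comp hy)).congr fun a =>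
    map_sub_rev (projectivePower p k) _ _

theorem tendsto_projectivePower_sub_map {α : Type*} {l : Filter α} {F : α → V →ₗ[ℂ] V}
    (hF : ∀ x, Tendsto (fun a => p (x - F a x)) l (𝓝 0)) (X : ⨂[ℂ]^k V) :
    Tendsto (fun a => projectivePower p k (X - PiTensorProduct.map (fun _ => F a) X)) l (𝓝 0) := by
  induction X using PiTensorProduct.induction_on with
  | add X Y hX hY =>
    refine squeeze_zero (fun a => apply_nonneg _ _) (fun a => ?_) (by simpa using hX.add hY)
    rw [map_add, add_sub_add_comm]
    exact map_add_le_add _ _ _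
  | smul_tprod c x =>
    have hx := (tendsto_projectivePower_tprod_sub fun m => hF (x m)).const_mul ‖c‖
    rw [mul_zero] at hx
    refine hx.congr fun a => ?_
    rw [map_smul, PiTensorProduct.map_tprod, ← smul_sub, map_smul_eq_mul]

theorem projectivePower_le_of_tendsto {α : Type*} {l : Filter α} [l.NeBot] {F : α → V →ₗ[ℂ] V}
    (hF : ∀ x, Tendsto (fun a => p (x - F a x)) l (𝓝 0)) {X : ⨂[ℂ]^k V} {C : ℝ}
    (hC : ∀ a, projectivePower p k (PiTensorProduct.map (fun _ => F a) X) ≤ C) :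
    projectivePower p k X ≤ C := by
  have hlim := (tendsto_projectivePower_sub_map hF X).add_const C
  rw [zero_add] at hlim
  refine ge_of_tendsto' hlim fun a => ?_
  have hsplit := map_add_le_add (projectivePower p k)
    (X - PiTensorProduct.map (fun _ => F a) X) (PiTensorProduct.map (fun _ => F a) X)
  rw [sub_add_cancel] at hsplit
  linarith [hC a]

/-- The finite-rank map `y ↦ ∑ᵢ ⟨eᵢ, y⟩ wᵢ`, with `i` running through the finite set `s`. -/
def PosHermForm.finiteRank (B : PosHermForm H) (e : ι → H) (w : ι → V) (s : Finset ι) :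
    H →ₗ[ℂ] V :=
  ∑ i ∈ s, (B.form (e i)).smulRight (w i)

theorem PosHermForm.finiteRank_apply (B : PosHermForm H) (e : ι → H) (w : ι → V) (s : Finset ι)
    (y : H) : B.finiteRank e w s y = ∑ i ∈ s, B.form (e i) y • w i := by
  simp [finiteRank]

open Fintype in
theorem PosHermForm.map_finiteRank (B : PosHermForm H) (e : ι → H) (w : ι → V) (s : Finset ι)
    (Y : ⨂[ℂ]^k H) :
    PiTensorProduct.map (fun _ => B.finiteRank e w s) Y = ∑ r ∈ piFinset fun _ : Fin k => s,
      (B.power k).form (PiTensorProduct.tprod ℂ fun m => e (r m)) Y •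
        PiTensorProduct.tprod ℂ fun m => w (r m) := by
  induction Y using PiTensorProduct.induction_on with
  | add X Y hX hY => simp only [map_add, add_smul, Finset.sum_add_distrib, hX, hY]
  | smul_tprod c y =>
    simp only [map_smul, smul_assoc, ← Finset.smul_sum, PiTensorProduct.map_tprod,
      finiteRank_apply, MultilinearMap.map_sum_finset, MultilinearMap.map_smul_univ, power,
      powerForm_tprod]

open Fintype in
theorem PosHermForm.IsOrthonormal.projectivePower_map_finiteRank_le [DecidableEq ι]
    {B : PosHermForm H} {e : ι → H} (he : B.IsOrthonormal e) {w : ι → V} {s : Finset ι} {ρ : ℝ}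
    (hρ : 0 ≤ ρ) (hw : ∑ i ∈ s, p (w i) ^ 2 ≤ ρ ^ 2) (Y : ⨂[ℂ]^k H) :
    projectivePower p k (PiTensorProduct.map (fun _ => B.finiteRank e w s) Y) ≤
      ρ ^ k * (B.power k).seminorm Y := by
  let I := piFinset fun _ : Fin k => s
  let a : (Fin k → ι) → ℝ := fun r =>
    ‖(B.power k).form (PiTensorProduct.tprod ℂ fun m => e (r m)) Y‖
  let b : (Fin k → ι) → ℝ := fun r => ∏ m, p (w (r m))
  have hb : ∑ r ∈ I, b r ^ 2 = (∑ i ∈ s, p (w i) ^ 2) ^ k := by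
    simp only [b, I, Finset.sum_pow', Finset.prod_pow]
  have ha : ∑ r ∈ I, a r ^ 2 ≤ (B.power k).seminorm Y ^ 2 := (he.power k).sum_norm_sq_le I Y
  calc projectivePower p k (PiTensorProduct.map (fun _ => B.finiteRank e w s) Y)
      ≤ ∑ r ∈ I, a r * b r := by
        rw [B.map_finiteRank]
        exact projectivePower_sum_tprod_le p I _ _
    _ ≤ √(∑ r ∈ I, a r ^ 2) * √(∑ r ∈ I, b r ^ 2) := Real.sum_mul_le_sqrt_mul_sqrt I a b
    _ ≤ (B.power k).seminorm Y * ρ ^ k := by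
        gcongr
        · exact Real.sqrt_le_iff.2 ⟨apply_nonneg _ _, ha⟩
        · rw [Real.sqrt_le_left (by positivity), hb, ← pow_mul, mul_comm k, pow_mul]
          gcongr
    _ = ρ ^ k * (B.power k).seminorm Y := mul_comm _ _

theorem PosHermForm.IsOrthonormal.projectivePower_le [DecidableEq ι] {B : PosHermForm H}
    {e : ι → H} (he : B.IsOrthonormal e) {T : V →ₗ[ℂ] H} {w : ι → V} {ρ : ℝ} (hρ : 0 ≤ ρ)
    (hw : ∀ s : Finset ι, ∑ i ∈ s, p (w i) ^ 2 ≤ ρ ^ 2)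
    (hT : ∀ x, Tendsto (fun s => p (x - B.finiteRank e w s (T x))) atTop (𝓝 0)) (X : ⨂[ℂ]^k V) :
    projectivePower p k X ≤ ρ ^ k * ((B.comap T).power k).seminorm X := by
  refine projectivePower_le_of_tendsto (F := fun s => B.finiteRank e w s ∘ₗ T) hT fun s => ?_
  rw [PiTensorProduct.map_comp, LinearMap.comp_apply, power_comap_seminorm]
  exact he.projectivePower_map_finiteRank_le hρ (hw s) _

theorem PosHermForm.power_seminorm_tprod (B : PosHermForm V) (x : Fin k → V) :
    (B.power k).seminorm (PiTensorProduct.tprod ℂ x) = ∏ m, B.seminorm (x m) := by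
  have h : ∀ y, B.form y y = ((B.form y y).re : ℂ) := fun y =>
    (Complex.conj_eq_iff_re.1 (B.conj_symm y y)).symm
  change √(B.powerForm k _ _).re = ∏ m, √_
  rw [powerForm_tprod, Finset.prod_congr rfl fun m _ => h (x m), ← Complex.ofReal_prod,
    Complex.ofReal_re, Real.sqrt_prod _ fun m _ => B.nonneg _]

theorem PosHermForm.power_seminorm_le (B : PosHermForm V) (X : ⨂[ℂ]^k V) :
    (B.power k).seminorm X ≤ projectivePower B.seminorm k X := by
  refine le_csInf (projectiveValues_nonempty _ k X) ?_
  rintro _ ⟨n, c, x, rfl, rfl⟩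
  calc (B.power k).seminorm (∑ i, c i • PiTensorProduct.tprod ℂ (x i))
      ≤ ∑ i, (B.power k).seminorm (c i • PiTensorProduct.tprod ℂ (x i)) :=
        Finset.le_sum_of_subadditive _ (map_zero _).le (map_add_le_add _) _ _
    _ = ∑ i, ‖c i‖ * ∏ m, B.seminorm (x i m) := by
        simp only [map_smul_eq_mul, B.power_seminorm_tprod]

end ProjectivePower

section Tens

theorem finsum_directSum_eq_sum {ι M : Type*} {β : ι → Type*} [∀ i, AddCommMonoid (β i)]
    [AddCommMonoid M] {f : ∀ i, β i → M} (hf : ∀ i, f i 0 = 0) (X : ⨁ i, β i) :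
    ∑ᶠ i, f i (X i) = ∑ i ∈ (DFinsupp.finite_support X).toFinset, f i (X i) :=
  finsum_eq_sum_of_support_subset _ fun i hi =>
    (Set.Finite.mem_toFinset _).2 fun hX => hi ((congrArg (f i) hX).trans (hf i))

variable {V : Type*} [AddCommGroup V] [Module ℂ V]

theorem PosHermForm.tens_seminorm_sq (B : PosHermForm V) (X : Tens V) :
    B.tens.seminorm X ^ 2 = ∑ k ∈ (DFinsupp.finite_support X).toFinset,
      ((k.factorial : ℝ) ^ (1 / 2 : ℝ) * (B.power k).seminorm (X k)) ^ 2 := by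
  rw [seminorm_sq, tens_apply, finsum_directSum_eq_sum (f := fun k Y => _ * B.powerForm k Y Y)
    (by simp), Complex.re_sum]
  refine Finset.sum_congr rfl fun k _ => ?_
  rw [mul_pow, ← Real.sqrt_eq_rpow, Real.sq_sqrt (by positivity), seminorm_sq]
  simp [power]

theorem PosHermForm.factorial_mul_power_seminorm_le_tens (B : PosHermForm V) (X : Tens V) (k : ℕ) :
    (k.factorial : ℝ) ^ (1 / 2 : ℝ) * (B.power k).seminorm (X k) ≤ B.tens.seminorm X := by
  by_cases hk : X k = 0
  · simp [hk]
  refine le_of_sq_le_sq ?_ (apply_nonneg _ _)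
  rw [tens_seminorm_sq]
  exact Finset.single_le_sum
    (f := fun k => ((k.factorial : ℝ) ^ (1 / 2 : ℝ) * (B.power k).seminorm (X k)) ^ 2)
    (fun k _ => by positivity) ((DFinsupp.finite_support X).mem_toFinset.2 hk)

theorem projectiveTens_eq_sum (R : ℝ) (p : Seminorm ℂ V) (X : Tens V) :
    projectiveTens R p X = ∑ k ∈ (DFinsupp.finite_support X).toFinset,
      (k.factorial : ℝ) ^ R * projectivePower p k (X k) := by
  rw [projectiveTens_apply,
    finsum_directSum_eq_sum (f := fun k Y => _ * projectivePower p k Y) (by simp)]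

theorem PosHermForm.tens_seminorm_le (B : PosHermForm V) :
    B.tens.seminorm ≤ projectiveTens (1 / 2) B.seminorm := fun X => by
  rw [projectiveTens_eq_sum]
  have hsum : B.tens.seminorm X ≤ ∑ k ∈ (DFinsupp.finite_support X).toFinset,
      (k.factorial : ℝ) ^ (1 / 2 : ℝ) * (B.power k).seminorm (X k) := by
    refine le_of_sq_le_sq ?_ (by positivity)
    rw [tens_seminorm_sq]
    exact Finset.sum_sq_le_sq_sum_of_nonneg fun k _ => by positivity
  refine hsum.trans (Finset.sum_le_sum fun k _ => ?_)
  gcongr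
  exact B.power_seminorm_le (X k)

theorem projectiveTens_le {p : Seminorm ℂ V} {B : PosHermForm V} {c : ℕ → ℝ≥0} (hc : Summable c)
    (h : ∀ k X, projectivePower p k X ≤ c k * (B.power k).seminorm X) :
    projectiveTens (1 / 2) p ≤ (∑' k, c k) • B.tens.seminorm := fun X => by
  rw [projectiveTens_eq_sum]
  set s := (DFinsupp.finite_support X).toFinset
  calc ∑ k ∈ s, (k.factorial : ℝ) ^ (1 / 2 : ℝ) * projectivePower p k (X k)
      ≤ ∑ k ∈ s, c k * ((k.factorial : ℝ) ^ (1 / 2 : ℝ) * (B.power k).seminorm (X k)) :=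
        Finset.sum_le_sum fun k _ => by
          rw [mul_left_comm]
          gcongr
          exact h k (X k)
    _ ≤ ∑ k ∈ s, c k * B.tens.seminorm X := by
        gcongr with k
        exact B.factorial_mul_power_seminorm_le_tens X k
    _ ≤ (∑' k, c k : ℝ≥0) * B.tens.seminorm X := by
        rw [← Finset.sum_mul]
        gcongr
        exact_mod_cast hc.sum_le_tsum s fun _ _ => zero_le

end Tens

section Topology

variable {V : Type*} [AddCommGroup V] [Module ℂ V]

theorem continuous_of_norm_le_seminorm {𝕜 E H : Type*} [NormedField 𝕜] [AddCommGroup E]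
    [Module 𝕜 E] [TopologicalSpace E] [IsTopologicalAddGroup E] [SeminormedAddCommGroup H]
    [NormedSpace 𝕜 H] {T : E →ₗ[𝕜] H} {q : Seminorm 𝕜 E} (hq : Continuous q) {C : ℝ}
    (hT : ∀ x, ‖T x‖ ≤ C * q x) : Continuous T := by
  refine continuous_of_continuousAt_zero T ?_
  rw [ContinuousAt, map_zero]
  refine squeeze_zero_norm hT ?_
  simpa using (hq.tendsto 0).const_mul C

theorem ContPosHermForm.continuous_seminorm [TopologicalSpace V] (B : ContPosHermForm V) :
    Continuous B.1.seminorm :=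
  Real.continuous_sqrt.comp (Complex.continuous_re.comp
    (B.2.comp (continuous_id.prodMk continuous_id)))

theorem IsNuclearMap.exists_projectivePower_le [TopologicalSpace V] [IsTopologicalAddGroup V]
    {p q : Seminorm ℂ V} {h : p ≤ q} (hn : IsNuclearMap (localBanachMap h)) (hq : Continuous q)
    {ρ : ℝ} (hρ : 0 < ρ) :
    ∃ B : ContPosHermForm V, ∀ k X, projectivePower p k X ≤ ρ ^ k * (B.1.power k).seminorm X := by
  obtain ⟨Φ, C, w, hΦ, hw, hlim⟩ := hn.exists_l2_expansion (sq_pos_of_pos hρ)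
  have hΦ_cont : Continuous Φ := continuous_of_norm_le_seminorm hq hΦ
  let B := (PosHermForm.ofInner ℓ²(ℕ × ℕ, ℂ)).comap Φ
  have hB : Continuous fun v : V × V => B.form v.1 v.2 :=
    (hΦ_cont.comp continuous_fst).inner (hΦ_cont.comp continuous_snd)
  refine ⟨⟨B, hB⟩, fun k X => (PosHermForm.isOrthonormal_single (ℕ × ℕ)).projectivePower_le hρ.le hw
    (fun x => (hlim x).congr fun s => ?_) X⟩
  simp only [PosHermForm.finiteRank_apply, PosHermForm.ofInner, innerₛₗ_apply_apply,
    lp.inner_single_left, RCLike.inner_apply, map_one, mul_one]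

theorem IsNuclearMap.exists_projectiveTens_le [TopologicalSpace V] [IsTopologicalAddGroup V]
    {p q : Seminorm ℂ V} {h : p ≤ q} (hn : IsNuclearMap (localBanachMap h)) (hq : Continuous q) :
    ∃ (B : ContPosHermForm V) (C : ℝ≥0), projectiveTens (1 / 2) p ≤ C • B.1.tens.seminorm := by
  obtain ⟨B, hB⟩ := hn.exists_projectivePower_le hq one_half_pos
  exact ⟨B, _, projectiveTens_le (c := fun k => (1 / 2) ^ k)
    (NNReal.summable_geometric (half_lt_self one_pos)) (by simpa using hB)⟩

theorem moduleFilterBasis_topology_eq {𝕜 E ι ι' : Type*} [NormedField 𝕜] [AddCommGroup E]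
    [Module 𝕜 E] {p : SeminormFamily 𝕜 E ι} {q : SeminormFamily 𝕜 E ι'}
    (hpq : ∀ i, ∃ (j : ι') (C : ℝ≥0), p i ≤ C • q j)
    (hqp : ∀ j, ∃ (i : ι) (C : ℝ≥0), q j ≤ C • p i) :
    p.moduleFilterBasis.topology = q.moduleFilterBasis.topology := by
  let _ : TopologicalSpace E := p.moduleFilterBasis.topology
  have hp : WithSeminorms p := ⟨rfl⟩
  refine (hp.congr (fun j => ?_) fun i => ?_).topology_eq_withSeminorms
  · obtain ⟨i, C, h⟩ := hqp j
    exact ⟨{i}, C, by simpa using h⟩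
  · obtain ⟨j, C, h⟩ := hpq i
    exact ⟨{j}, C, by simpa using h⟩

/-- The topology on `⨁ₖ V^{⊗k}` defined by the seminorms `X ↦ ∑ₖ (k!)ᴿ p^{⊗k}(Xₖ)` for `p ∈ P`;
`symProjectiveTopologyOf` is the subspace topology it induces on the symmetric tensors. -/
abbrev projectiveTopologyOf (R : ℝ) (P : Set (Seminorm ℂ V)) : TopologicalSpace (Tens V) :=
  (SeminormFamily.moduleFilterBasis
    (fun p : P => projectiveTens R p.1 : SeminormFamily ℂ (Tens V) _)).topology

end Topology

end NuclearWeyl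

end

theorem proposition4p5_general {V : Type*} [AddCommGroup V] [Module ℂ V] [TopologicalSpace V]
    [IsTopologicalAddGroup V]
    (hV : ∀ p : Seminorm ℂ V, Continuous p → ∃ (q : Seminorm ℂ V) (h : p ≤ q),
      Continuous q ∧ NuclearWeyl.IsNuclearMap (NuclearWeyl.localBanachMap h))
    {P : Set (Seminorm ℂ V)} (hP : NuclearWeyl.hilbertSeminorms V ⊆ P)
    (hP' : ∀ p ∈ P, Continuous p) :
    NuclearWeyl.hilbertTopology V = NuclearWeyl.projectiveTopologyOf (1 / 2) P := by
  refine NuclearWeyl.moduleFilterBasis_topology_eq (fun B => ?_) fun ⟨p, hp⟩ => ?_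
  · exact ⟨⟨_, hP ⟨B, rfl⟩⟩, 1, by simpa using B.1.tens_seminorm_le⟩
  · obtain ⟨q, hpq, hq, hn⟩ := hV p (hP' p hp)
    exact hn.exists_projectiveTens_le hq

/-- For a nuclear space `V`, the topology on the symmetric tensors defined by the extensions of
the continuous Hilbert seminorms is the projective topology with parameter `R = 1/2`; it does not
matter whether the latter is built from all continuous seminorms of `V` or from the continuous
Hilbert seminorms only. -/
theorem proposition4p5 {V : Type*} [AddCommGroup V] [Module ℂ V] [TopologicalSpace V]
    (hV : NuclearWeyl.IsNuclearSpace V) :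
    NuclearWeyl.symHilbertTopology V = NuclearWeyl.symProjectiveTopology V (1 / 2) ∧
      NuclearWeyl.symHilbertTopology V =
        NuclearWeyl.symProjectiveTopologyOf (1 / 2) (NuclearWeyl.hilbertSeminorms V) := by
  have := hV.locallyConvex
  have := (PolynormableSpace.withSeminorms ℂ V).topologicalAddGroup
  have hcont : ∀ p ∈ NuclearWeyl.hilbertSeminorms V, Continuous p := by
    rintro _ ⟨B, rfl⟩
    exact B.continuous_seminorm
  exact ⟨congrArg (TopologicalSpace.induced Subtype.val)
      (proposition4p5_general hV.exists_nuclear hcont fun _ hp => hp),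
    congrArg (TopologicalSpace.induced Subtype.val)
      (proposition4p5_general hV.exists_nuclear subset_rfl hcont)⟩
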